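/- Let $\Xi$ be a complete separable metric space (the mark space). A network is a multigraph in which every vertex carries a mark in $\Xi$ and every edge carries two marks in $\Xi$, one at each of its endpoints. Isomorphisms of networks are bijections of vertices and edges that preserve incidences and marks. Let $\mathcal G_*$ be the set of isomorphism classes $[G,o]$ of connected locally finite networks $G$ with a root $o$ (isomorphisms preserving the root), with the metric in which $[G_1,o_1]$ and $[G_2,o_2]$ are at distance $1/(1+\alpha)$, where $\alpha$ is the supremum of those $r>0$ such that some rooted isomorphism of the balls of graph-distance radius $\lfloor r\rfloor$ around the roots brings each pair of corresponding marks within distance less than $1/r$. Let $\mathcal G_{**}$ be the analogous space of isomorphism classes of connected locally finite networks $(G,x,y)$ with an ordered pair of distinguished vertices, with the analogous topology. A Borel probability measure $\mu$ on $\mathcal G_*$ is called unimodular if for every Borel $f:\mathcal G_{**}\to[0,\infty]$, $$\int \sum_{x\in V(G)} f(G,o,x)\,d\mu([G,o]) = \int \sum_{x\in V(G)} f(G,x,o)\,d\mu([G,o]).$$ Let $\mathcal U$ be the (convex) set of unimodular probability measures, and let $\mathcal I$ be the $\sigma$-field of Borel sets $A\subseteq\mathcal G_*$ that are invariant under non-rooted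 isomorphisms (if $[G,x]\in A$, $H$ is isomorphic to $G$ as a network, and $y\in V(H)$, then $[H,y]\in A$). Theorem (Extremality). A measure $\mu\in\mathcal U$ is extremal, i.e. is not a non-trivial convex combination of other elements of $\mathcal U$, if and only if $\mathcal I$ is $\mu$-trivial, i.e. $\mu(A)\in\{0,1\}$ for every $A\in\mathcal I$. -/

import Mathlib

open MeasureTheory
open scoped ENNReal NNReal

universe u

/-- A multigraph (loops and multiple edges allowed), given by its vertices and its half-edges.
An undirected edge is a pair `{d, rev d}` of half-edges; the half-edge `d` sits at the
endpoint `src d`, and the other endpoint is `src (rev d)`. -/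
structure Multigraph where
  V : Type
  D : Type
  src : D → V
  rev : D → D
  rev_rev : ∀ d, rev (rev d) = d
  rev_ne : ∀ d, rev d ≠ d

namespace Multigraph

/-- Adjacency: some edge joins `x` and `y`. -/
def Adj (G : Multigraph) (x y : G.V) : Prop :=
  ∃ d, G.src d = x ∧ G.src (G.rev d) = y

/-- Any two vertices are joined by a path. -/
def Connected (G : Multigraph) : Prop :=
  ∀ x y : G.V, Relation.ReflTransGen G.Adj x y

/-- All degrees are finite. -/
def LocallyFinite (G : Multigraph) : Prop :=
  ∀ x : G.V, {d | G.src d = x}.Finite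

/-- The vertices at graph distance at most `n` from the set `s`. -/
def ball (G : Multigraph) (s : Set G.V) : ℕ → Set G.V
  | 0 => s
  | n + 1 => {y | y ∈ G.ball s n ∨ ∃ x ∈ G.ball s n, G.Adj x y}

/-- The subgraph induced by a set of vertices. -/
def induce (G : Multigraph) (s : Set G.V) : Multigraph where
  V := {x : G.V // x ∈ s}
  D := {d : G.D // G.src d ∈ s ∧ G.src (G.rev d) ∈ s}
  src d := ⟨G.src d.1, d.2.1⟩
  rev d := ⟨G.rev d.1, d.2.2, by rw [G.rev_rev]; exact d.2.1⟩
  rev_rev d := Subtype.ext (G.rev_rev d.1)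
  rev_ne d h := G.rev_ne d.1 (congrArg Subtype.val h)

/-- An isomorphism of multigraphs: a bijection of the vertices and a bijection of the half-edges
that respect endpoints and edges. -/
structure Iso (G H : Multigraph) where
  toV : G.V ≃ H.V
  toD : G.D ≃ H.D
  map_src : ∀ d, H.src (toD d) = toV (G.src d)
  map_rev : ∀ d, H.rev (toD d) = toD (G.rev d)

namespace Iso

def refl (G : Multigraph) : Iso G G := ⟨Equiv.refl _, Equiv.refl _, fun _ => rfl, fun _ => rfl⟩

def symm {G H : Multigraph} (φ : Iso G H) : Iso H G where
  toV := φ.toV.symm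
  toD := φ.toD.symm
  map_src d := by
    rw [Equiv.eq_symm_apply, ← φ.map_src, Equiv.apply_symm_apply]
  map_rev d := by
    rw [Equiv.eq_symm_apply, ← φ.map_rev, Equiv.apply_symm_apply]

def trans {G H K : Multigraph} (φ : Iso G H) (ψ : Iso H K) : Iso G K where
  toV := φ.toV.trans ψ.toV
  toD := φ.toD.trans ψ.toD
  map_src d := by simp [ψ.map_src, φ.map_src]
  map_rev d := by simp [ψ.map_rev, φ.map_rev]

end Iso

theorem ball_mono (G : Multigraph) (s : Set G.V) {m n : ℕ} (h : m ≤ n) :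
    G.ball s m ⊆ G.ball s n := by
  induction h with
  | refl => exact subset_rfl
  | step _ ih => exact fun x hx => Or.inl (ih hx)

theorem Iso.map_ball {G H : Multigraph} (φ : Iso G H) {s : Set G.V} {t : Set H.V}
    (hst : ∀ x ∈ s, φ.toV x ∈ t) (n : ℕ) : ∀ x ∈ G.ball s n, φ.toV x ∈ H.ball t n := by
  induction n with
  | zero => exact hst
  | succ n ih =>
    rintro x (hx | ⟨y, hy, d, rfl, rfl⟩)
    · exact Or.inl (ih x hx)
    · exact Or.inr ⟨_, ih _ hy, φ.toD d, φ.map_src d, by rw [φ.map_rev, φ.map_src]⟩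

/-- An isomorphism of two balls of radius `R` that respects the centres maps the balls of a smaller
radius into each other. -/
theorem Iso.map_ball_induce {G H : Multigraph} {s : Set G.V} {t : Set H.V} {R : ℕ}
    (φ : Iso (G.induce (G.ball s R)) (H.induce (H.ball t R)))
    (hst : ∀ x (hx : x ∈ G.ball s R), x ∈ s → (φ.toV ⟨x, hx⟩).1 ∈ t) {n : ℕ} (hn : n ≤ R) :
    ∀ x (hx : x ∈ G.ball s R), x ∈ G.ball s n → (φ.toV ⟨x, hx⟩).1 ∈ H.ball t n := by
  induction n with
  | zero => exact hst
  | succ n ih =>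
    have ih := ih (Nat.le_of_succ_le hn)
    rintro x hx (hx' | ⟨y, hy, d, rfl, rfl⟩)
    · exact Or.inl (ih x hx hx')
    · have hyR := G.ball_mono s (Nat.le_of_succ_le hn) hy
      refine Or.inr ⟨_, ih _ hyR hy, (φ.toD ⟨d, hyR, hx⟩).1, ?_, ?_⟩
      · exact congrArg Subtype.val (φ.map_src ⟨d, hyR, hx⟩)
      · have h1 := φ.map_rev ⟨d, hyR, hx⟩
        have h2 := φ.map_src ((G.induce (G.ball s R)).rev ⟨d, hyR, hx⟩)
        rw [← h1] at h2
        exact congrArg Subtype.val h2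

theorem Iso.map_dart_induce {G H : Multigraph} {s : Set G.V} {t : Set H.V} {R : ℕ}
    (φ : Iso (G.induce (G.ball s R)) (H.induce (H.ball t R)))
    (hst : ∀ x (hx : x ∈ G.ball s R), x ∈ s → (φ.toV ⟨x, hx⟩).1 ∈ t) {n : ℕ} (hn : n ≤ R)
    (d : G.D) (hd : G.src d ∈ G.ball s R ∧ G.src (G.rev d) ∈ G.ball s R)
    (hd' : G.src d ∈ G.ball s n ∧ G.src (G.rev d) ∈ G.ball s n) :
    H.src (φ.toD ⟨d, hd⟩).1 ∈ H.ball t n ∧ H.src (H.rev (φ.toD ⟨d, hd⟩).1) ∈ H.ball t n := by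
  have e1 : H.src (φ.toD ⟨d, hd⟩).1 = (φ.toV ⟨G.src d, hd.1⟩).1 :=
    congrArg Subtype.val (φ.map_src ⟨d, hd⟩)
  have e2 : H.src (H.rev (φ.toD ⟨d, hd⟩).1) = (φ.toV ⟨G.src (G.rev d), hd.2⟩).1 := by
    have h1 := φ.map_rev ⟨d, hd⟩
    have h2 := φ.map_src ((G.induce (G.ball s R)).rev ⟨d, hd⟩)
    exact congrArg Subtype.val ((congrArg (H.induce (H.ball t R)).src h1).trans h2)
  rw [e1, e2]
  exact ⟨φ.map_ball_induce hst hn _ _ hd'.1, φ.map_ball_induce hst hn _ _ hd'.2⟩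

/-- Restriction of an isomorphism between two balls to concentric balls of a smaller radius. -/
def Iso.restrict {G H : Multigraph} {s : Set G.V} {t : Set H.V} {R n : ℕ}
    (φ : Iso (G.induce (G.ball s R)) (H.induce (H.ball t R)))
    (hst : ∀ x (hx : x ∈ G.ball s R), x ∈ s → (φ.toV ⟨x, hx⟩).1 ∈ t)
    (hts : ∀ x (hx : x ∈ H.ball t R), x ∈ t → (φ.toV.symm ⟨x, hx⟩).1 ∈ s) (hn : n ≤ R) :
    Iso (G.induce (G.ball s n)) (H.induce (H.ball t n)) where
  toV :=
    { toFun := fun x => ⟨(φ.toV ⟨x.1, G.ball_mono s hn x.2⟩).1,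
        φ.map_ball_induce hst hn _ _ x.2⟩
      invFun := fun x => ⟨(φ.toV.symm ⟨x.1, H.ball_mono t hn x.2⟩).1,
        φ.symm.map_ball_induce hts hn _ _ x.2⟩
      left_inv := fun x => by
        have h := φ.toV.symm_apply_apply ⟨x.1, G.ball_mono s hn x.2⟩
        exact Subtype.ext (congrArg Subtype.val h :)
      right_inv := fun x => by
        have h := φ.toV.apply_symm_apply ⟨x.1, H.ball_mono t hn x.2⟩
        exact Subtype.ext (congrArg Subtype.val h :) }
  toD :=
    { toFun := fun d => ⟨(φ.toD ⟨d.1, G.ball_mono s hn d.2.1, G.ball_mono s hn d.2.2⟩).1,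
        φ.map_dart_induce hst hn _ _ d.2⟩
      invFun := fun d => ⟨(φ.toD.symm ⟨d.1, H.ball_mono t hn d.2.1, H.ball_mono t hn d.2.2⟩).1,
        φ.symm.map_dart_induce hts hn _ _ d.2⟩
      left_inv := fun d => by
        have h := φ.toD.symm_apply_apply ⟨d.1, G.ball_mono s hn d.2.1, G.ball_mono s hn d.2.2⟩
        exact Subtype.ext (congrArg Subtype.val h :)
      right_inv := fun d => by
        have h := φ.toD.apply_symm_apply ⟨d.1, H.ball_mono t hn d.2.1, H.ball_mono t hn d.2.2⟩
        exact Subtype.ext (congrArg Subtype.val h :) }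
  map_src d := by
    have h := φ.map_src ⟨d.1, G.ball_mono s hn d.2.1, G.ball_mono s hn d.2.2⟩
    exact Subtype.ext (congrArg Subtype.val h :)
  map_rev d := by
    have h := φ.map_rev ⟨d.1, G.ball_mono s hn d.2.1, G.ball_mono s hn d.2.2⟩
    exact Subtype.ext (congrArg Subtype.val h :)

end Multigraph

/-- A connected locally finite network with mark space `Ξ`: every vertex carries a mark, and every
edge `{d, rev d}` carries two marks, `dmark d` at its endpoint `src d` and `dmark (rev d)` at its
endpoint `src (rev d)`. -/
structure Network (Ξ : Type u) extends Multigraph where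
  vmark : V → Ξ
  dmark : D → Ξ
  connected : toMultigraph.Connected
  locallyFinite : toMultigraph.LocallyFinite

/-- An isomorphism of networks (roots play no role). -/
structure Network.Iso {Ξ : Type u} (N M : Network Ξ)
    extends Multigraph.Iso N.toMultigraph M.toMultigraph where
  map_vmark : ∀ x, M.vmark (toV x) = N.vmark x
  map_dmark : ∀ d, M.dmark (toD d) = N.dmark d

namespace Network.Iso

variable {Ξ : Type u} {N M K : Network Ξ}

def refl (N : Network Ξ) : N.Iso N :=
  ⟨Multigraph.Iso.refl _, fun _ => rfl, fun _ => rfl⟩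

def symm (φ : N.Iso M) : M.Iso N where
  toIso := φ.toIso.symm
  map_vmark x := by
    rw [← φ.map_vmark]; exact congrArg M.vmark (φ.toV.apply_symm_apply x)
  map_dmark d := by
    rw [← φ.map_dmark]; exact congrArg M.dmark (φ.toD.apply_symm_apply d)

def trans (φ : N.Iso M) (ψ : M.Iso K) : N.Iso K where
  toIso := φ.toIso.trans ψ.toIso
  map_vmark x := (ψ.map_vmark _).trans (φ.map_vmark x)
  map_dmark d := (ψ.map_dmark _).trans (φ.map_dmark d)

end Network.Iso

/-- A connected locally finite network with an ordered `k`-tuple of distinguished vertices.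
For `k = 1` this is a rooted network. -/
structure PointedNetwork (Ξ : Type u) (k : ℕ) where
  net : Network Ξ
  pt : Fin k → net.V

namespace PointedNetwork

variable {Ξ : Type u} {k : ℕ}

/-- `(G, x)`: the network `G` rooted at `x`. -/
def rooted (N : Network Ξ) (x : N.V) : PointedNetwork Ξ 1 := ⟨N, ![x]⟩

/-- `(G, x, y)`: the network `G` with the ordered pair of distinguished vertices `x`, `y`. -/
def birooted (N : Network Ξ) (x y : N.V) : PointedNetwork Ξ 2 := ⟨N, ![x, y]⟩

/-- The root of a rooted network. -/
def root (P : PointedNetwork Ξ 1) : P.net.V := P.pt 0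

/-- `P` and `Q` are isomorphic by an isomorphism of networks that maps the distinguished vertices
of `P` to those of `Q`, in their order. -/
def Isomorphic (P Q : PointedNetwork Ξ k) : Prop :=
  ∃ φ : P.net.Iso Q.net, ∀ i, φ.toV (P.pt i) = Q.pt i

instance setoid (Ξ : Type u) (k : ℕ) : Setoid (PointedNetwork Ξ k) where
  r := Isomorphic
  iseqv :=
    { refl := fun P => ⟨Network.Iso.refl _, fun _ => rfl⟩
      symm := by
        rintro P Q ⟨φ, h⟩
        exact ⟨φ.symm, fun i => (Equiv.symm_apply_eq φ.toV).2 (h i).symm⟩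
      trans := by
        rintro P Q S ⟨φ, h⟩ ⟨ψ, h'⟩
        exact ⟨φ.trans ψ, fun i => (congrArg ψ.toV (h i)).trans (h' i)⟩ }

/-- The vertices at graph distance at most `R` from the distinguished vertices. -/
def ballSet (P : PointedNetwork Ξ k) (R : ℕ) : Set P.net.V :=
  P.net.ball (Set.range P.pt) R

/-- The ball of radius `R` around the distinguished vertices, as an induced subgraph. -/
def ballGraph (P : PointedNetwork Ξ k) (R : ℕ) : Multigraph :=
  P.net.induce (P.ballSet R)

/-- A distinguished vertex, as a vertex of the ball. -/
def ballPt (P : PointedNetwork Ξ k) (R : ℕ) (i : Fin k) : (P.ballGraph R).V :=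
  ⟨P.pt i, P.net.ball_mono _ (Nat.zero_le R) ⟨i, rfl⟩⟩

/-- There is an isomorphism of the balls of radius `R` around the distinguished vertices which
respects these and is such that corresponding marks are at distance less than `δ`. -/
def Close [MetricSpace Ξ] (R : ℕ) (δ : ℝ) (P Q : PointedNetwork Ξ k) : Prop :=
  ∃ φ : (P.ballGraph R).Iso (Q.ballGraph R),
    (∀ i, φ.toV (P.ballPt R i) = Q.ballPt R i) ∧
    (∀ x, dist (P.net.vmark x.1) (Q.net.vmark (φ.toV x).1) < δ) ∧
    (∀ d, dist (P.net.dmark d.1) (Q.net.dmark (φ.toD d).1) < δ)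

section

variable [MetricSpace Ξ]

theorem Close.symm {R : ℕ} {δ : ℝ} {P Q : PointedNetwork Ξ k} (h : Close R δ P Q) :
    Close R δ Q P := by
  obtain ⟨φ, h0, h1, h2⟩ := h
  refine ⟨φ.symm, fun i => (Equiv.symm_apply_eq φ.toV).2 (h0 i).symm, fun x => ?_, fun d => ?_⟩
  · have := h1 (φ.toV.symm x)
    rw [Equiv.apply_symm_apply, dist_comm] at this
    exact this
  · have := h2 (φ.toD.symm d)
    rw [Equiv.apply_symm_apply, dist_comm] at this
    exact this

theorem Close.refl {R : ℕ} {δ : ℝ} (hδ : 0 < δ) (P : PointedNetwork Ξ k) : Close R δ P P :=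
  ⟨Multigraph.Iso.refl _, fun _ => rfl, fun _ => (dist_self _).trans_lt hδ,
    fun _ => (dist_self _).trans_lt hδ⟩

theorem Close.trans {R : ℕ} {δ δ' : ℝ} {P Q S : PointedNetwork Ξ k} (h : Close R δ P Q)
    (h' : Close R δ' Q S) : Close R (δ + δ') P S := by
  obtain ⟨φ, h0, h1, h2⟩ := h
  obtain ⟨ψ, h0', h1', h2'⟩ := h'
  exact ⟨φ.trans ψ, fun i => (congrArg ψ.toV (h0 i)).trans (h0' i),
    fun x => (dist_triangle _ _ _).trans_lt (add_lt_add (h1 x) (h1' _)),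
    fun d => (dist_triangle _ _ _).trans_lt (add_lt_add (h2 d) (h2' _))⟩

theorem Close.mono {R n : ℕ} {δ δ' : ℝ} (hn : n ≤ R) (hδ : δ ≤ δ') {P Q : PointedNetwork Ξ k}
    (h : Close R δ P Q) : Close n δ' P Q := by
  obtain ⟨φ, h0, h1, h2⟩ := h
  have hst : ∀ x (hx : x ∈ P.ballSet R), x ∈ Set.range P.pt →
      (φ.toV ⟨x, hx⟩).1 ∈ Set.range Q.pt := by
    rintro _ hx ⟨i, rfl⟩
    exact ⟨i, (congrArg Subtype.val (h0 i)).symm⟩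
  have hts : ∀ x (hx : x ∈ Q.ballSet R), x ∈ Set.range Q.pt →
      (φ.toV.symm ⟨x, hx⟩).1 ∈ Set.range P.pt := by
    rintro _ hx ⟨i, rfl⟩
    exact ⟨i, congrArg Subtype.val ((Equiv.symm_apply_eq φ.toV).2 (h0 i).symm).symm⟩
  refine ⟨Multigraph.Iso.restrict φ hst hts hn, fun i => ?_, fun x => ?_, fun d => ?_⟩
  · exact Subtype.ext (congrArg Subtype.val (h0 i) :)
  · exact (h1 ⟨x.1, P.net.ball_mono _ hn x.2⟩).trans_le hδ
  · exact (h2 ⟨d.1, P.net.ball_mono _ hn d.2.1, P.net.ball_mono _ hn d.2.2⟩).trans_le hδ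

theorem Close.congr_left {R : ℕ} {δ : ℝ} {P P' Q : PointedNetwork Ξ k} (e : Isomorphic P' P)
    (h : Close R δ P Q) : Close R δ P' Q := by
  obtain ⟨e, he⟩ := e
  obtain ⟨φ, h0, h1, h2⟩ := h
  have hR : R ≤ R := le_rfl
  have key : ∀ x, x ∈ P'.ballSet R ↔ e.toV x ∈ P.ballSet R := by
    intro x
    refine ⟨e.toIso.map_ball ?_ R x, fun hx => ?_⟩
    · rintro _ ⟨i, rfl⟩
      exact ⟨i, (he i).symm⟩
    · have := e.symm.toIso.map_ball (s := Set.range P.pt) (t := Set.range P'.pt) ?_ R _ hx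
      · have e1 : e.symm.toV (e.toV x) = x := e.toV.symm_apply_apply x
        rw [e1] at this
        exact this
      · rintro _ ⟨i, rfl⟩
        exact ⟨i, ((Equiv.symm_apply_eq e.toV).2 (he i).symm).symm⟩
  let ε : (P'.ballGraph R).Iso (P.ballGraph R) :=
    { toV := e.toV.subtypeEquiv key
      toD := e.toD.subtypeEquiv fun d => by
        rw [e.map_rev, e.map_src, e.map_src, ← key, ← key]
      map_src := fun d => Subtype.ext (e.map_src d.1)
      map_rev := fun d => Subtype.ext (e.map_rev d.1) }
  refine ⟨ε.trans φ, fun i => ?_, fun x => ?_, fun d => ?_⟩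
  · have : ε.toV (P'.ballPt R i) = P.ballPt R i := Subtype.ext (he i)
    exact (congrArg φ.toV this).trans (h0 i)
  · rw [← e.map_vmark]; exact h1 (ε.toV x)
  · rw [← e.map_dmark]; exact h2 (ε.toD d)

theorem close_congr {R : ℕ} {δ : ℝ} {P P' Q Q' : PointedNetwork Ξ k} (e : P ≈ P') (e' : Q ≈ Q') :
    Close R δ P Q ↔ Close R δ P' Q' :=
  ⟨fun h => ((h.congr_left (Setoid.symm e)).symm.congr_left (Setoid.symm e')).symm,
    fun h => ((h.congr_left e).symm.congr_left e').symm⟩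

/-- The supremum of those `r > 0` such that some isomorphism of the balls of radius `⌊r⌋` brings
all corresponding marks within distance less than `1 / r`. -/
noncomputable def agreement (P Q : PointedNetwork Ξ k) : ℝ≥0∞ :=
  ⨆ (r : ℝ) (_ : 0 < r ∧ Close ⌊r⌋₊ (1 / r) P Q), ENNReal.ofReal r

theorem agreement_congr {P P' Q Q' : PointedNetwork Ξ k} (e : P ≈ P') (e' : Q ≈ Q') :
    agreement P Q = agreement P' Q' := by
  unfold agreement
  simp_rw [close_congr e e']

/-- The local distance `1 / (1 + α)`, where `α` is the supremum above. -/
noncomputable def localDist (P Q : PointedNetwork Ξ k) : ℝ≥0∞ := (1 + agreement P Q)⁻¹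

theorem exists_close_of_localDist_lt {P Q : PointedNetwork Ξ k} {c : ℝ≥0∞}
    (h : localDist P Q < c) (hc : c ≤ 1) :
    ∃ r : ℝ, 0 < r ∧ Close ⌊r⌋₊ (1 / r) P Q ∧ ENNReal.ofReal (1 / (1 + r)) < c := by
  unfold localDist at h
  rw [ENNReal.inv_lt_iff_inv_lt] at h
  have h1 : c⁻¹ - 1 < agreement P Q := by
    refine ENNReal.sub_lt_of_lt_add (ENNReal.one_le_inv.2 hc) ?_
    rwa [add_comm]
  simp only [agreement, lt_iSup_iff] at h1
  obtain ⟨r, ⟨hr, hcl⟩, h2⟩ := h1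
  refine ⟨r, hr, hcl, ?_⟩
  rw [one_div, ENNReal.ofReal_inv_of_pos (by positivity), ENNReal.inv_lt_iff_inv_lt,
    ENNReal.ofReal_add zero_le_one hr.le, ENNReal.ofReal_one, add_comm]
  have h3 := ENNReal.add_lt_add_right ENNReal.one_ne_top h2
  rwa [tsub_add_cancel_of_le (ENNReal.one_le_inv.2 hc)] at h3

theorem localDist_le_of_close {P Q : PointedNetwork Ξ k} {r : ℝ} (hr : 0 < r)
    (h : Close ⌊r⌋₊ (1 / r) P Q) : localDist P Q ≤ ENNReal.ofReal (1 / (1 + r)) := by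
  rw [one_div, ENNReal.ofReal_inv_of_pos (by positivity), ENNReal.ofReal_add zero_le_one hr.le,
    ENNReal.ofReal_one]
  unfold localDist
  gcongr
  exact le_iSup₂_of_le (f := fun (r : ℝ) (_ : 0 < r ∧ Close ⌊r⌋₊ (1 / r) P Q) => ENNReal.ofReal r)
    r ⟨hr, h⟩ le_rfl

theorem localDist_self (P : PointedNetwork Ξ k) : localDist P P = 0 := by
  have : agreement P P = ⊤ := by
    refine ENNReal.eq_top_of_forall_nnreal_le fun q => ?_
    have hq : (0 : ℝ) < q + 1 := by positivity
    refine le_iSup₂_of_le (f := fun (r : ℝ) (_ : 0 < r ∧ Close ⌊r⌋₊ (1 / r) P P) =>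
      ENNReal.ofReal r) (q + 1 : ℝ) ⟨hq, Close.refl (by positivity) P⟩ ?_
    rw [← ENNReal.ofReal_coe_nnreal]
    exact ENNReal.ofReal_le_ofReal (by linarith)
  simp [localDist, this]

theorem localDist_comm (P Q : PointedNetwork Ξ k) : localDist P Q = localDist Q P := by
  have : ∀ r : ℝ, (0 < r ∧ Close ⌊r⌋₊ (1 / r) P Q) ↔ (0 < r ∧ Close ⌊r⌋₊ (1 / r) Q P) :=
    fun r => and_congr_right fun _ => ⟨Close.symm, Close.symm⟩
  unfold localDist agreement
  simp_rw [this]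

theorem localDist_le_one (P Q : PointedNetwork Ξ k) : localDist P Q ≤ 1 :=
  ENNReal.inv_le_one.2 le_self_add

theorem localDist_triangle (P Q S : PointedNetwork Ξ k) :
    localDist P S ≤ localDist P Q + localDist Q S := by
  by_contra! hlt
  obtain ⟨a, ha, b, hb, hab⟩ : ∃ a, localDist P Q < a ∧ ∃ b, localDist Q S < b ∧
      a + b < localDist P S := by
    obtain ⟨c, hc, hc'⟩ := exists_between hlt
    have hfin : ∀ P Q : PointedNetwork Ξ k, localDist P Q ≠ ⊤ := fun P Q =>
      ne_top_of_le_ne_top ENNReal.one_ne_top (localDist_le_one P Q)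
    set x := localDist P Q
    set y := localDist Q S
    have hd : 0 < c - (x + y) := tsub_pos_of_lt hc
    have hctop : c ≠ ⊤ := hc'.ne_top
    have hd' : 0 < (c - (x + y)) / 2 := ENNReal.half_pos hd.ne'
    refine ⟨x + (c - (x + y)) / 2, ENNReal.lt_add_right (hfin P Q) hd'.ne',
      y + (c - (x + y)) / 2, ENNReal.lt_add_right (hfin Q S) hd'.ne', ?_⟩
    rw [add_add_add_comm, ENNReal.add_halves, add_tsub_cancel_of_le hc.le]
    exact hc'
  have h1 : a + b < 1 := hab.trans_le (localDist_le_one P S)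
  obtain ⟨r, hr, hPQ, hra⟩ := exists_close_of_localDist_lt ha (le_self_add.trans h1.le)
  obtain ⟨s, hs, hQS, hsb⟩ := exists_close_of_localDist_lt hb (le_add_self.trans h1.le)
  have hq : 0 < r * s / (r + s) := by positivity
  have hqr : r * s / (r + s) ≤ r := by
    rw [div_le_iff₀ (by positivity)]; nlinarith [mul_pos hr hs]
  have hqs : r * s / (r + s) ≤ s := by
    rw [div_le_iff₀ (by positivity)]; nlinarith [mul_pos hr hs]
  have hcl : Close ⌊r * s / (r + s)⌋₊ (1 / (r * s / (r + s))) P S := by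
    have := (hPQ.mono (Nat.floor_le_floor hqr) le_rfl).trans
      (hQS.mono (Nat.floor_le_floor hqs) le_rfl)
    refine this.mono le_rfl (le_of_eq ?_)
    field_simp
    ring
  have hle := localDist_le_of_close hq hcl
  have hreal : 1 / (1 + r * s / (r + s)) ≤ 1 / (1 + r) + 1 / (1 + s) := by
    have e : 1 / (1 + r) + 1 / (1 + s) - 1 / (1 + r * s / (r + s)) =
        (r + s + 2 * (r * s)) / ((1 + r) * (1 + s) * (r + s + r * s)) := by
      field_simp
      ring
    have : 0 ≤ (r + s + 2 * (r * s)) / ((1 + r) * (1 + s) * (r + s + r * s)) := by positivity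
    linarith
  have := calc localDist P S ≤ ENNReal.ofReal (1 / (1 + r * s / (r + s))) := hle
    _ ≤ ENNReal.ofReal (1 / (1 + r) + 1 / (1 + s)) := ENNReal.ofReal_le_ofReal hreal
    _ = ENNReal.ofReal (1 / (1 + r)) + ENNReal.ofReal (1 / (1 + s)) :=
      ENNReal.ofReal_add (by positivity) (by positivity)
    _ ≤ a + b := add_le_add hra.le hsb.le
  exact absurd hab (not_lt.2 this)

end

end PointedNetwork

/-- Isomorphism classes of connected locally finite networks with `k` distinguished vertices. -/
def NetworkClass (Ξ : Type u) (k : ℕ) : Type (max 1 u) :=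
  Quotient (PointedNetwork.setoid Ξ k)

namespace NetworkClass

variable {Ξ : Type u} {k : ℕ}

/-- The isomorphism class of a network with distinguished vertices. -/
def mk (P : PointedNetwork Ξ k) : NetworkClass Ξ k := Quotient.mk _ P

/-- The space of classes carries the local distance (bounded by `1`). -/
noncomputable instance [MetricSpace Ξ] : PseudoEMetricSpace (NetworkClass Ξ k) where
  edist := Quotient.lift₂ PointedNetwork.localDist fun _ _ _ _ h h' => by
    unfold PointedNetwork.localDist
    rw [PointedNetwork.agreement_congr h h']
  edist_self := by
    rintro ⟨P⟩
    exact PointedNetwork.localDist_self P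
  edist_comm := by
    rintro ⟨P⟩ ⟨Q⟩
    exact PointedNetwork.localDist_comm P Q
  edist_triangle := by
    rintro ⟨P⟩ ⟨Q⟩ ⟨S⟩
    exact PointedNetwork.localDist_triangle P Q S

noncomputable instance [MetricSpace Ξ] : MeasurableSpace (NetworkClass Ξ k) := borel _

instance [MetricSpace Ξ] : BorelSpace (NetworkClass Ξ k) := ⟨rfl⟩

end NetworkClass

/-- The space `𝒢_*` of rooted isomorphism classes of rooted connected locally finite networks. -/
abbrev GStar (Ξ : Type u) : Type (max 1 u) := NetworkClass Ξ 1

/-- The space `𝒢_**` of isomorphism classes of connected locally finite networks with an ordered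
pair of distinguished vertices. -/
abbrev GStarStar (Ξ : Type u) : Type (max 1 u) := NetworkClass Ξ 2

open PointedNetwork in
/-- The total mass `∑ x, f (G, o, x)` sent by the root of `[G, o]`. -/
noncomputable def massOut {Ξ : Type u} (f : GStarStar Ξ → ℝ≥0∞) : GStar Ξ → ℝ≥0∞ :=
  Quotient.lift (fun P : PointedNetwork Ξ 1 =>
    ∑' x : P.net.V, f (NetworkClass.mk (birooted P.net P.root x))) <| by
    rintro P Q ⟨φ, h⟩
    refine Eq.trans (tsum_congr fun x => ?_)
      (φ.toV.tsum_eq fun x => f (NetworkClass.mk (birooted Q.net Q.root x)))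
    refine congrArg f (Quotient.sound ⟨φ, fun i => ?_⟩)
    fin_cases i
    · exact h 0
    · rfl

open PointedNetwork in
/-- The total mass `∑ x, f (G, x, o)` received by the root of `[G, o]`. -/
noncomputable def massIn {Ξ : Type u} (f : GStarStar Ξ → ℝ≥0∞) : GStar Ξ → ℝ≥0∞ :=
  Quotient.lift (fun P : PointedNetwork Ξ 1 =>
    ∑' x : P.net.V, f (NetworkClass.mk (birooted P.net x P.root))) <| by
    rintro P Q ⟨φ, h⟩
    refine Eq.trans (tsum_congr fun x => ?_)
      (φ.toV.tsum_eq fun x => f (NetworkClass.mk (birooted Q.net x Q.root)))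
    refine congrArg f (Quotient.sound ⟨φ, fun i => ?_⟩)
    fin_cases i
    · rfl
    · exact h 0

/-- The set `𝒰` of unimodular probability measures on `𝒢_*`: those that obey the Mass-Transport
Principle. -/
def unimodular (Ξ : Type u) [MetricSpace Ξ] : Set (Measure (GStar Ξ)) :=
  {μ | IsProbabilityMeasure μ ∧ ∀ f : GStarStar Ξ → ℝ≥0∞, Measurable f →
    ∫⁻ g, massOut f g ∂μ = ∫⁻ g, massIn f g ∂μ}

/-- A set of classes of rooted networks is invariant under non-rooted isomorphisms if, whenever
it contains `[G, x]` and `G` is isomorphic to `H` (with no condition on roots), it contains `[H, y]`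
for every vertex `y` of `H`. -/
def RootInvariant {Ξ : Type u} (A : Set (GStar Ξ)) : Prop :=
  ∀ (G H : Network Ξ) (x : G.V) (y : H.V), Nonempty (G.Iso H) →
    NetworkClass.mk (PointedNetwork.rooted G x) ∈ A →
    NetworkClass.mk (PointedNetwork.rooted H y) ∈ A

/-- The σ-field of Borel sets in `𝒢_*` that are invariant under non-rooted isomorphisms. -/
@[reducible] def invariantSigma (Ξ : Type u) [MetricSpace Ξ] : MeasurableSpace (GStar Ξ) where
  MeasurableSet' A := MeasurableSet A ∧ RootInvariant A
  measurableSet_empty := ⟨MeasurableSet.empty, fun _ _ _ _ _ h => h.elim⟩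
  measurableSet_compl A h := by
    refine ⟨h.1.compl, ?_⟩
    rintro G H x y ⟨φ⟩ hx hy
    exact hx (h.2 H G y x ⟨φ.symm⟩ hy)
  measurableSet_iUnion A h := by
    refine ⟨MeasurableSet.iUnion fun i => (h i).1, ?_⟩
    rintro G H x y φ hx
    obtain ⟨i, hi⟩ := Set.mem_iUnion.1 hx
    exact Set.mem_iUnion.2 ⟨i, (h i).2 G H x y φ hi⟩

/-- A σ-field `m` is `μ`-trivial if all its elements have `μ`-measure `0` or `1`. -/
def IsTrivialFor {α : Type*} (m : MeasurableSpace α) {_ : MeasurableSpace α} (μ : Measure α) : Prop :=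
  ∀ A, MeasurableSet[m] A → μ A = 0 ∨ μ A = 1

/-! Suppose an invariant event `A` has probability strictly between 0 and 1. Then `μ` is the mixture
of its conditionings on `A` and `Aᶜ`. Both are unimodular (`cond_mem_unimodular`): the indicator of
`A` is constant along each network, so it can be absorbed into the transported mass. Extremality
makes `μ` equal to its conditioning on `A`, which gives `μ A = 1`.

Conversely, let the invariant σ-field be `μ`-trivial and let `ν` be a component of `μ` of positive
weight. Then `ν ≪ μ`, with density `h`. Mass transport for `μ` and for `ν` together move the factor
`h` between the sender and the receiver of any mass (`lintegral_massOut_snd_mul`). Let vertices with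
`h ≤ 1` send unit mass to nearby vertices with `h > 1`. Weighting by `h` at the sender cannot
increase the total, while weighting at the receiver strictly increases it unless almost surely
nothing is sent. So, almost surely, `h > 1` somewhere on the network forces `h > 1` at the root
(`ae_one_lt_of_mem_saturation`). The event that `h > 1` somewhere is invariant, hence of probability
0 or 1; so `h ≤ 1` a.e. or `h ≥ 1` a.e., and `∫ h = 1` gives `h = 1` a.e.

These arguments need vertex sums to be Borel functions of the rooted class. For open sets of pairs
the sum is lower semicontinuous (`lowerSemicontinuous_massOut_indicator`), and a π-λ argument on
pairs at bounded distance extends this to Borel sets. -/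

/-! ### Balls and restrictions of isomorphisms. -/

namespace Multigraph

theorem ball_ball_subset (G : Multigraph) {s t : Set G.V} {m n R : ℕ} (hst : s ⊆ G.ball t m)
    (h : m + n ≤ R) : G.ball s n ⊆ G.ball t R := by
  refine subset_trans ?_ (G.ball_mono t h)
  clear h
  induction n with
  | zero => exact hst
  | succ n ih =>
    rintro x (hx | ⟨y, hy, hxy⟩)
    · exact Or.inl (ih hx)
    · exact Or.inr ⟨y, ih hy, hxy⟩

theorem ball_finite {G : Multigraph} (hG : G.LocallyFinite) {s : Set G.V} (hs : s.Finite)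
    (n : ℕ) : (G.ball s n).Finite := by
  induction n with
  | zero => exact hs
  | succ n ih =>
    refine (ih.union (ih.biUnion fun x _ =>
      (hG x).image fun d => G.src (G.rev d))).subset ?_
    rintro y (hy | ⟨x, hx, d, hd, rfl⟩)
    · exact Or.inl hy
    · exact Or.inr (Set.mem_biUnion hx ⟨d, hd, rfl⟩)

theorem Connected.exists_mem_ball {G : Multigraph} (hG : G.Connected) (x y : G.V) :
    ∃ n, y ∈ G.ball {x} n := by
  induction hG x y with
  | refl => exact ⟨0, rfl⟩
  | tail _ h ih =>
    obtain ⟨n, hn⟩ := ih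
    exact ⟨n + 1, Or.inr ⟨_, hn, h⟩⟩

/-- Paths of length at most `n` from `s` stay inside `S`, so their images are paths. Here `S` need
not be a ball around `s`, which allows a change of centre. -/
theorem Iso.map_ball_of_subset {G H : Multigraph} {S s : Set G.V} {T t : Set H.V}
    (φ : Iso (G.induce S) (H.induce T)) {n : ℕ} (hS : G.ball s n ⊆ S)
    (hst : ∀ x (hx : x ∈ S), x ∈ s → (φ.toV ⟨x, hx⟩).1 ∈ t) :
    ∀ x (hx : x ∈ S), x ∈ G.ball s n → (φ.toV ⟨x, hx⟩).1 ∈ H.ball t n := by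
  induction n with
  | zero => exact hst
  | succ n ih =>
    have hS' : G.ball s n ⊆ S := fun x hx => hS (Or.inl hx)
    rintro x hx (hx' | ⟨y, hy, d, rfl, rfl⟩)
    · exact Or.inl (ih hS' x hx hx')
    · refine Or.inr ⟨_, ih hS' _ (hS' hy) hy, (φ.toD ⟨d, hS' hy, hx⟩).1, ?_, ?_⟩
      · exact congrArg Subtype.val (φ.map_src ⟨d, hS' hy, hx⟩)
      · have h1 := φ.map_rev ⟨d, hS' hy, hx⟩
        have h2 := φ.map_src ((G.induce S).rev ⟨d, hS' hy, hx⟩)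
        rw [← h1] at h2
        exact congrArg Subtype.val h2

/-- Restriction of an isomorphism of induced subgraphs to smaller induced subgraphs. -/
def Iso.restrictTo {G H : Multigraph} {S S' : Set G.V} {T T' : Set H.V}
    (φ : Iso (G.induce S) (H.induce T)) (hS : S' ⊆ S) (hT : T' ⊆ T)
    (h : ∀ x (hx : x ∈ S), x ∈ S' → (φ.toV ⟨x, hx⟩).1 ∈ T')
    (h' : ∀ x (hx : x ∈ T), x ∈ T' → (φ.toV.symm ⟨x, hx⟩).1 ∈ S') :
    Iso (G.induce S') (H.induce T') where
  toV :=
    { toFun := fun x => ⟨(φ.toV ⟨x.1, hS x.2⟩).1, h _ _ x.2⟩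
      invFun := fun x => ⟨(φ.toV.symm ⟨x.1, hT x.2⟩).1, h' _ _ x.2⟩
      left_inv := fun x =>
        Subtype.ext (congrArg Subtype.val (φ.toV.symm_apply_apply ⟨x.1, hS x.2⟩) :)
      right_inv := fun x =>
        Subtype.ext (congrArg Subtype.val (φ.toV.apply_symm_apply ⟨x.1, hT x.2⟩) :) }
  toD :=
    { toFun := fun d => ⟨(φ.toD ⟨d.1, hS d.2.1, hS d.2.2⟩).1, by
        have e1 := congrArg Subtype.val (φ.map_src ⟨d.1, hS d.2.1, hS d.2.2⟩)
        have e2 := congrArg Subtype.val ((congrArg (H.induce T).src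
          (φ.map_rev ⟨d.1, hS d.2.1, hS d.2.2⟩)).trans
            (φ.map_src ((G.induce S).rev ⟨d.1, hS d.2.1, hS d.2.2⟩)))
        exact ⟨(congrArg (· ∈ T') e1).mpr (h _ _ d.2.1),
          (congrArg (· ∈ T') e2).mpr (h _ _ d.2.2)⟩⟩
      invFun := fun d => ⟨(φ.toD.symm ⟨d.1, hT d.2.1, hT d.2.2⟩).1, by
        have e1 := congrArg Subtype.val (φ.symm.map_src ⟨d.1, hT d.2.1, hT d.2.2⟩)
        have e2 := congrArg Subtype.val ((congrArg (G.induce S).src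
          (φ.symm.map_rev ⟨d.1, hT d.2.1, hT d.2.2⟩)).trans
            (φ.symm.map_src ((H.induce T).rev ⟨d.1, hT d.2.1, hT d.2.2⟩)))
        exact ⟨(congrArg (· ∈ S') e1).mpr (h' _ _ d.2.1),
          (congrArg (· ∈ S') e2).mpr (h' _ _ d.2.2)⟩⟩
      left_inv := fun d =>
        Subtype.ext (congrArg Subtype.val
          (φ.toD.symm_apply_apply ⟨d.1, hS d.2.1, hS d.2.2⟩) :)
      right_inv := fun d =>
        Subtype.ext (congrArg Subtype.val
          (φ.toD.apply_symm_apply ⟨d.1, hT d.2.1, hT d.2.2⟩) :) }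
  map_src d :=
    Subtype.ext (congrArg Subtype.val (φ.map_src ⟨d.1, hS d.2.1, hS d.2.2⟩) :)
  map_rev d :=
    Subtype.ext (congrArg Subtype.val (φ.map_rev ⟨d.1, hS d.2.1, hS d.2.2⟩) :)

end Multigraph

/-! ### Changing the distinguished vertices of close networks. -/

namespace PointedNetwork

variable {Ξ : Type u} {k l : ℕ}

theorem mem_ballSet_of_iso {P Q : PointedNetwork Ξ k} {R m : ℕ}
    (φ : (P.ballGraph R).Iso (Q.ballGraph R)) (h0 : ∀ i, φ.toV (P.ballPt R i) = Q.ballPt R i)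
    (hm : m ≤ R) (x : (P.ballGraph R).V) (hx : x.1 ∈ P.ballSet m) :
    (φ.toV x).1 ∈ Q.ballSet m := by
  refine Multigraph.Iso.map_ball_induce φ ?_ hm x.1 x.2 hx
  rintro _ hx ⟨i, rfl⟩
  exact ⟨i, (congrArg Subtype.val (h0 i)).symm⟩

theorem rooted_root (P : PointedNetwork Ξ 1) : rooted P.net P.root = P := by
  obtain ⟨N, p⟩ := P
  simp only [rooted, root, mk.injEq, heq_eq_eq, true_and]
  ext i
  fin_cases i
  rfl

theorem birooted_pt (P : PointedNetwork Ξ 2) : birooted P.net (P.pt 0) (P.pt 1) = P := by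
  obtain ⟨N, p⟩ := P
  simp only [birooted, mk.injEq, heq_eq_eq, true_and]
  ext i
  fin_cases i <;> rfl

variable [MetricSpace Ξ]

/-- An isomorphism of balls that almost preserves marks makes any choice of new distinguished
vertices inside the ball close to its image. -/
theorem close_of_iso {P Q : PointedNetwork Ξ k} {R m n : ℕ} {δ : ℝ}
    (φ : (P.ballGraph R).Iso (Q.ballGraph R)) (h0 : ∀ i, φ.toV (P.ballPt R i) = Q.ballPt R i)
    (h1 : ∀ x, dist (P.net.vmark x.1) (Q.net.vmark (φ.toV x).1) < δ)
    (h2 : ∀ d, dist (P.net.dmark d.1) (Q.net.dmark (φ.toD d).1) < δ)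
    (p : Fin l → (P.ballGraph R).V) (hp : ∀ i, (p i).1 ∈ P.ballSet m) (hmn : m + n ≤ R) :
    Close n δ (⟨P.net, fun i => (p i).1⟩ : PointedNetwork Ξ l)
      ⟨Q.net, fun i => (φ.toV (p i)).1⟩ := by
  have hS : P.net.ball (Set.range fun i => (p i).1) n ⊆ P.ballSet R :=
    P.net.ball_ball_subset (by rintro _ ⟨i, rfl⟩; exact hp i) hmn
  have hT : Q.net.ball (Set.range fun i => (φ.toV (p i)).1) n ⊆ Q.ballSet R := by
    refine Q.net.ball_ball_subset ?_ hmn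
    rintro _ ⟨i, rfl⟩
    exact mem_ballSet_of_iso φ h0 (by omega) _ (hp i)
  refine ⟨Multigraph.Iso.restrictTo φ hS hT
    (Multigraph.Iso.map_ball_of_subset φ hS ?_)
    (Multigraph.Iso.map_ball_of_subset (Multigraph.Iso.symm φ) hT ?_), ?_, ?_, ?_⟩
  · rintro _ hx ⟨i, rfl⟩
    exact ⟨i, rfl⟩
  · rintro _ hx ⟨i, rfl⟩
    exact ⟨i, (congrArg Subtype.val (φ.toV.symm_apply_apply (p i))).symm⟩
  · exact fun i => rfl
  · exact fun x => h1 ⟨x.1, hS x.2⟩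
  · exact fun d => h2 ⟨d.1, hS d.2.1, hS d.2.2⟩

/-- Reindexing of the distinguished vertices. -/
def reindex (σ : Fin l → Fin k) (P : PointedNetwork Ξ k) : PointedNetwork Ξ l :=
  ⟨P.net, P.pt ∘ σ⟩

/-- The new distinguished vertices are among the old ones, at distance 0 from them, so no radius is
lost. -/
theorem Close.reindex {P Q : PointedNetwork Ξ k} {R : ℕ} {δ : ℝ} (h : Close R δ P Q)
    (σ : Fin l → Fin k) : Close R δ (P.reindex σ) (Q.reindex σ) := by
  obtain ⟨φ, h0, h1, h2⟩ := h
  have := close_of_iso (m := 0) (n := R) φ h0 h1 h2 (fun i => P.ballPt R (σ i))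
    (fun i => ⟨σ i, rfl⟩) (by omega)
  simp only [h0] at this
  exact this

end PointedNetwork

/-! ### Topology of the spaces of classes. -/

namespace NetworkClass

open PointedNetwork Topology

variable {Ξ : Type u} {k l : ℕ}

theorem exists_rep (g : NetworkClass Ξ k) : ∃ P, mk P = g := Quotient.exists_rep g

theorem exists_rooted (g : GStar Ξ) : ∃ (N : Network Ξ) (x : N.V), mk (rooted N x) = g := by
  obtain ⟨P, rfl⟩ := exists_rep g
  exact ⟨P.net, P.root, by rw [rooted_root]⟩

theorem exists_birooted (g : GStarStar Ξ) :
    ∃ (N : Network Ξ) (x y : N.V), mk (birooted N x y) = g := by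
  obtain ⟨P, rfl⟩ := exists_rep g
  exact ⟨P.net, P.pt 0, P.pt 1, by rw [birooted_pt]⟩

/-- Reindexing of the distinguished vertices, on isomorphism classes. -/
def reindex (σ : Fin l → Fin k) : NetworkClass Ξ k → NetworkClass Ξ l :=
  Quotient.map (PointedNetwork.reindex σ) fun _ _ ⟨φ, h⟩ => ⟨φ, fun i => h (σ i)⟩

/-- `[G, x, y] ↦ [G, x]`. -/
def fst : GStarStar Ξ → GStar Ξ := reindex ![0]

/-- `[G, x, y] ↦ [G, y]`. -/
def snd : GStarStar Ξ → GStar Ξ := reindex ![1]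

/-- `[G, x, y] ↦ [G, y, x]`. -/
def swap : GStarStar Ξ → GStarStar Ξ := reindex ![1, 0]

theorem fst_mk (N : Network Ξ) (x y : N.V) : fst (mk (birooted N x y)) = mk (rooted N x) := by
  refine congrArg mk ?_
  simp only [PointedNetwork.reindex, birooted, rooted, PointedNetwork.mk.injEq, heq_eq_eq, true_and]
  ext i
  fin_cases i
  rfl

theorem snd_mk (N : Network Ξ) (x y : N.V) : snd (mk (birooted N x y)) = mk (rooted N y) := by
  refine congrArg mk ?_
  simp only [PointedNetwork.reindex, birooted, rooted, PointedNetwork.mk.injEq, heq_eq_eq, true_and]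
  ext i
  fin_cases i
  rfl

theorem swap_mk (N : Network Ξ) (x y : N.V) :
    swap (mk (birooted N x y)) = mk (birooted N y x) := by
  refine congrArg mk ?_
  simp only [PointedNetwork.reindex, birooted, PointedNetwork.mk.injEq, heq_eq_eq, true_and]
  ext i
  fin_cases i <;> rfl

/-- The classes `[G, x, y]` for which the distance from `x` to `y` is at most `n`. -/
def within (Ξ : Type u) (n : ℕ) : Set (GStarStar Ξ) :=
  {g | ∃ (N : Network Ξ) (x y : N.V), y ∈ N.ball {x} n ∧ mk (birooted N x y) = g}

theorem mk_mem_within {N : Network Ξ} {x y : N.V} {n : ℕ} :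
    mk (birooted N x y) ∈ within Ξ n ↔ y ∈ N.ball {x} n := by
  refine ⟨?_, fun h => ⟨N, x, y, h, rfl⟩⟩
  rintro ⟨M, a, b, hb, hab⟩
  obtain ⟨φ, hφ⟩ := Quotient.exact hab
  have h0 : φ.toV a = x := hφ 0
  have h1 : φ.toV b = y := hφ 1
  rw [← h1]
  exact φ.toIso.map_ball (s := ({a} : Set M.V)) (t := ({x} : Set N.V))
    (fun z hz => (congrArg φ.toV hz).trans h0) n b hb

variable [MetricSpace Ξ]

theorem edist_mk (P Q : PointedNetwork Ξ k) : edist (mk P) (mk Q) = localDist P Q := rfl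

/-- Distance below `1 / (1 + R)` yields closeness at some `r ≥ R`, hence at `R`. With
`exists_close_of_mem_nhds` this describes neighbourhoods by integer radii alone. -/
theorem eventually_of_close {P : PointedNetwork Ξ k} {R : ℕ} (hR : 0 < R)
    {p : NetworkClass Ξ k → Prop} (h : ∀ Q, Close R (1 / R) P Q → p (mk Q)) :
    ∀ᶠ g in 𝓝 (mk P), p g := by
  have hR' : (0 : ℝ) < R := by exact_mod_cast hR
  have hpos : 0 < ENNReal.ofReal (1 / (1 + R)) := ENNReal.ofReal_pos.2 (by positivity)
  filter_upwards [Metric.eball_mem_nhds (mk P) hpos] with g hg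
  obtain ⟨Q, rfl⟩ := exists_rep g
  rw [Metric.mem_eball, edist_comm, edist_mk] at hg
  obtain ⟨r, hr, hcl, hlt⟩ := exists_close_of_localDist_lt hg
    (ENNReal.ofReal_le_one.2 (by rw [div_le_one (by positivity)]; linarith))
  have hlt' := ENNReal.ofReal_lt_ofReal_iff_of_nonneg (by positivity) |>.1 hlt
  have hRr : (R : ℝ) ≤ r := by
    rw [one_div_lt_one_div (by positivity) (by positivity)] at hlt'
    linarith
  exact h Q (hcl.mono (Nat.le_floor hRr) (one_div_le_one_div_of_le hR' hRr))

theorem exists_close_of_mem_nhds {P : PointedNetwork Ξ k} {U : Set (NetworkClass Ξ k)}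
    (hU : U ∈ 𝓝 (mk P)) : ∃ R : ℕ, 0 < R ∧ ∀ Q, Close R (1 / R) P Q → mk Q ∈ U := by
  obtain ⟨ε, hε, h⟩ := EMetric.mem_nhds_iff.1 hU
  obtain ⟨n, hn⟩ := ENNReal.exists_inv_nat_lt hε.ne'
  refine ⟨n + 1, n.succ_pos, fun Q hQ => h ?_⟩
  rw [Metric.mem_eball, edist_comm, edist_mk]
  have hcl : Close ⌊((n + 1 : ℕ) : ℝ)⌋₊ (1 / ((n + 1 : ℕ) : ℝ)) P Q := by
    rwa [Nat.floor_natCast]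
  refine (localDist_le_of_close (by positivity) hcl).trans_lt (lt_of_le_of_lt ?_ hn)
  rw [one_div, ENNReal.ofReal_inv_of_pos (by positivity)]
  refine ENNReal.inv_le_inv.2 ?_
  rw [← ENNReal.ofReal_natCast n]
  exact ENNReal.ofReal_le_ofReal (by push_cast; linarith)

theorem continuous_reindex (σ : Fin l → Fin k) :
    Continuous (reindex σ : NetworkClass Ξ k → NetworkClass Ξ l) := by
  refine continuous_iff_continuousAt.2 fun g => ?_
  obtain ⟨P, rfl⟩ := exists_rep g
  intro U hU
  obtain ⟨R, hR, h⟩ := exists_close_of_mem_nhds (P := P.reindex σ) hU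
  exact eventually_of_close hR fun Q hQ => h _ (hQ.reindex σ)

theorem measurable_fst : Measurable (fst : GStarStar Ξ → GStar Ξ) :=
  (continuous_reindex _).measurable

theorem measurable_snd : Measurable (snd : GStarStar Ξ → GStar Ξ) :=
  (continuous_reindex _).measurable

theorem measurable_swap : Measurable (swap : GStarStar Ξ → GStarStar Ξ) :=
  (continuous_reindex _).measurable

/-- An isomorphism of balls around the pair preserves paths of length `n` from the first vertex.
Radius `n` would suffice; `n + 1` keeps it positive, as `eventually_of_close` requires. -/
theorem isOpen_within (n : ℕ) : IsOpen (within Ξ n) := by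
  rw [isOpen_iff_eventually]
  rintro _ ⟨N, x, y, hy, rfl⟩
  refine eventually_of_close (R := n + 1) n.succ_pos fun Q hQ => ?_
  obtain ⟨φ, h0, -, -⟩ := hQ
  rw [← birooted_pt Q, mk_mem_within]
  have hS : N.ball {x} n ⊆ (birooted N x y).ballSet (n + 1) :=
    N.ball_ball_subset (m := 0) (by rintro _ rfl; exact ⟨0, rfl⟩) (by omega)
  have e0 : (φ.toV ⟨x, (birooted N x y).net.ball_mono _ (Nat.zero_le _) ⟨0, rfl⟩⟩).1 = Q.pt 0 :=
    congrArg Subtype.val (h0 0)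
  have e1 : (φ.toV ⟨y, hS hy⟩).1 = Q.pt 1 := congrArg Subtype.val (h0 1)
  rw [← e1]
  refine Multigraph.Iso.map_ball_of_subset φ hS ?_ y (hS hy) hy
  intro z hz hzx
  have e : (⟨z, hz⟩ : ((birooted N x y).ballGraph (n + 1)).V) =
      ⟨x, (birooted N x y).net.ball_mono _ (Nat.zero_le _) ⟨0, rfl⟩⟩ := Subtype.ext hzx
  exact (congrArg (fun w => (φ.toV w).1) e).trans e0

end NetworkClass

/-! ### Algebra and measurability of mass transport. -/

namespace NetworkClass

open PointedNetwork Topology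

variable {Ξ : Type u}

theorem massOut_mk (f : GStarStar Ξ → ℝ≥0∞) (N : Network Ξ) (x : N.V) :
    massOut f (mk (rooted N x)) = ∑' y : N.V, f (mk (birooted N x y)) := rfl

theorem massIn_mk (f : GStarStar Ξ → ℝ≥0∞) (N : Network Ξ) (x : N.V) :
    massIn f (mk (rooted N x)) = ∑' y : N.V, f (mk (birooted N y x)) := rfl

theorem massIn_eq_massOut_swap (f : GStarStar Ξ → ℝ≥0∞) : massIn f = massOut (f ∘ swap) := by
  ext g
  obtain ⟨N, x, rfl⟩ := exists_rooted g
  simp only [massOut_mk, massIn_mk, Function.comp_apply, swap_mk]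

theorem massOut_add (f f' : GStarStar Ξ → ℝ≥0∞) : massOut (f + f') = massOut f + massOut f' := by
  ext g
  obtain ⟨N, x, rfl⟩ := exists_rooted g
  simp only [massOut_mk, Pi.add_apply, ENNReal.tsum_add]

theorem massOut_tsum (f : ℕ → GStarStar Ξ → ℝ≥0∞) :
    massOut (fun g => ∑' i, f i g) = fun g => ∑' i, massOut (f i) g := by
  ext g
  obtain ⟨N, x, rfl⟩ := exists_rooted g
  simp only [massOut_mk]
  exact ENNReal.tsum_comm

theorem massOut_iSup {f : ℕ → GStarStar Ξ → ℝ≥0∞} (hf : Monotone f) :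
    massOut (fun g => ⨆ i, f i g) = fun g => ⨆ i, massOut (f i) g := by
  ext g
  obtain ⟨N, x, rfl⟩ := exists_rooted g
  simp only [massOut_mk]
  -- The sum becomes an integral against counting measure, so that monotone convergence applies.
  let _ : MeasurableSpace N.V := ⊤
  have : MeasurableSingletonClass N.V := ⟨fun _ => trivial⟩
  simp only [← lintegral_count]
  exact lintegral_iSup (fun i => measurable_from_top) fun i j hij y => hf hij _

theorem massOut_const_mul (c : ℝ≥0∞) (f : GStarStar Ξ → ℝ≥0∞) :
    massOut (fun g => c * f g) = fun g => c * massOut f g := by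
  ext g
  obtain ⟨N, x, rfl⟩ := exists_rooted g
  simp only [massOut_mk, ENNReal.tsum_mul_left]

theorem massOut_fst_mul (h : GStar Ξ → ℝ≥0∞) (f : GStarStar Ξ → ℝ≥0∞) :
    massOut (fun g => h (fst g) * f g) = fun g => h g * massOut f g := by
  ext g
  obtain ⟨N, x, rfl⟩ := exists_rooted g
  simp only [massOut_mk, fst_mk, ENNReal.tsum_mul_left]

theorem massIn_snd_mul (h : GStar Ξ → ℝ≥0∞) (f : GStarStar Ξ → ℝ≥0∞) :
    massIn (fun g => h (snd g) * f g) = fun g => h g * massIn f g := by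
  ext g
  obtain ⟨N, x, rfl⟩ := exists_rooted g
  simp only [massIn_mk, snd_mk, ENNReal.tsum_mul_left]

theorem massOut_within_ne_top (n : ℕ) (g : GStar Ξ) :
    massOut ((within Ξ n).indicator 1) g ≠ ∞ := by
  obtain ⟨N, x, rfl⟩ := exists_rooted g
  have hfin := Multigraph.ball_finite N.locallyFinite (Set.finite_singleton x) n
  rw [massOut_mk, tsum_eq_sum (s := hfin.toFinset)]
  · refine ENNReal.sum_ne_top.2 fun y _ => ne_top_of_le_ne_top ENNReal.one_ne_top ?_
    exact Set.indicator_le_self' (by simp) _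
  · intro y hy
    rw [Set.Finite.mem_toFinset, ← mk_mem_within] at hy
    exact Set.indicator_of_notMem hy _

variable [MetricSpace Ξ]

/-- The sum counts the vertices `x` with `[G, o, x] ∈ U`. If it exceeds `c`, finitely many such `x`
witness this, and a network that agrees with `G` on a large ball around `o` has distinct copies of
them, still paired with the root inside `U`. -/
theorem lowerSemicontinuous_massOut_indicator {U : Set (GStarStar Ξ)} (hU : IsOpen U) :
    LowerSemicontinuous (massOut (U.indicator 1)) := by
  classical
  intro g c hc
  obtain ⟨N, o, rfl⟩ := exists_rooted g
  rw [massOut_mk, ENNReal.tsum_eq_iSup_sum, gt_iff_lt, lt_iSup_iff] at hc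
  obtain ⟨F, hF⟩ := hc
  set F' := F.filter fun x => mk (birooted N o x) ∈ U with hF'
  have hcard : c < (F'.card : ℝ≥0∞) := by
    refine hF.trans_le (le_of_eq ?_)
    rw [Finset.card_filter]
    push_cast
    exact Finset.sum_congr rfl fun x _ => by simp [Set.indicator_apply]
  choose m hm using fun x => N.connected.exists_mem_ball o x
  have hex : ∀ x : N.V, ∃ R : ℕ, mk (birooted N o x) ∈ U →
      0 < R ∧ ∀ Q, Close R (1 / R) (birooted N o x) Q → mk Q ∈ U := by
    intro x
    by_cases hx : mk (birooted N o x) ∈ U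
    · obtain ⟨R, h⟩ := exists_close_of_mem_nhds (hU.mem_nhds hx)
      exact ⟨R, fun _ => h⟩
    · exact ⟨0, fun h => absurd h hx⟩
  choose r hr using hex
  -- Radius `R₁` reaches every witness and `R₂` more covers the neighbourhood that certifies
  -- membership in `U`; the extra 1 below makes the radius positive.
  set R₁ := F'.sup m
  set R₂ := F'.sup r
  refine eventually_of_close (R := R₁ + R₂ + 1) (Nat.succ_pos _) fun Q hQ => ?_
  obtain ⟨φ, h0, h1, h2⟩ := hQ
  rw [← rooted_root Q, massOut_mk]
  have hmem : ∀ x ∈ F', x ∈ (rooted N o).ballSet R₁ := by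
    intro x hx
    refine N.ball_ball_subset (m := 0) ?_ (by simpa using Finset.le_sup hx) (hm x)
    rintro _ rfl
    exact ⟨0, rfl⟩
  have hmem' : ∀ x ∈ F', x ∈ (rooted N o).ballSet (R₁ + R₂ + 1) :=
    fun x hx => N.ball_mono _ (by omega) (hmem x hx)
  let j : F' → Q.net.V := fun x => (φ.toV ⟨x.1, hmem' x.1 x.2⟩).1
  have hj : Function.Injective j := by
    intro x y hxy
    have := φ.toV.injective (Subtype.ext hxy)
    have h := congrArg Subtype.val this
    exact Subtype.ext h
  have hjU : ∀ x, mk (birooted Q.net Q.root (j x)) ∈ U := by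
    intro x
    have hxU := (Finset.mem_filter.1 x.2).2
    obtain ⟨hpos, hcl⟩ := hr x.1 hxU
    have hle : r x.1 ≤ R₂ := Finset.le_sup x.2
    have := close_of_iso (m := R₁) (n := R₂) φ h0 h1 h2
      ![(rooted N o).ballPt _ 0, ⟨x.1, hmem' x.1 x.2⟩] (by
        intro i
        fin_cases i
        · exact (rooted N o).net.ball_mono _ (Nat.zero_le _) ⟨0, rfl⟩
        · exact hmem x.1 x.2) (by omega)
    refine hcl _ ?_
    have e1 : (⟨(rooted N o).net, fun i => (![(rooted N o).ballPt (R₁ + R₂ + 1) 0,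
        ⟨x.1, hmem' x.1 x.2⟩] i).1⟩ : PointedNetwork Ξ 2) = birooted N o x := by
      refine congrArg (PointedNetwork.mk N) (funext fun i => ?_)
      fin_cases i <;> rfl
    have e2 : (⟨Q.net, fun i => (φ.toV (![(rooted N o).ballPt (R₁ + R₂ + 1) 0,
        ⟨x.1, hmem' x.1 x.2⟩] i)).1⟩ : PointedNetwork Ξ 2) = birooted Q.net Q.root (j x) := by
      refine congrArg (PointedNetwork.mk Q.net) (funext fun i => ?_)
      fin_cases i
      · exact congrArg Subtype.val (h0 0)
      · rfl
    rw [e1, e2] at this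
    refine this.mono hle (one_div_le_one_div_of_le (by exact_mod_cast hpos) ?_)
    exact_mod_cast (by omega : r x.1 ≤ R₁ + R₂ + 1)
  calc c < (F'.card : ℝ≥0∞) := hcard
    _ = ∑' x : F', U.indicator 1 (mk (birooted Q.net Q.root (j x))) := by
      simp only [Set.indicator_of_mem (hjU _), Pi.one_apply, tsum_fintype]
      simp
    _ ≤ _ := ENNReal.tsum_comp_le_tsum_of_injective hj
      fun y => U.indicator (1 : GStarStar Ξ → ℝ≥0∞) (mk (birooted Q.net Q.root y))

/-- The complement step of the π-λ argument subtracts two sums. Restricting to distance at most `n`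
makes them finite, by local finiteness. -/
theorem measurable_massOut_indicator_inter_within (n : ℕ) {B : Set (GStarStar Ξ)}
    (hB : MeasurableSet B) : Measurable (massOut ((B ∩ within Ξ n).indicator 1)) := by
  have hopen : ∀ {U : Set (GStarStar Ξ)}, IsOpen U →
      Measurable (massOut ((U ∩ within Ξ n).indicator 1)) := fun hU =>
    (lowerSemicontinuous_massOut_indicator (hU.inter (isOpen_within n))).measurable
  induction B, hB using MeasurableSpace.induction_on_inter
    (show _ = MeasurableSpace.generateFrom {U : Set (GStarStar Ξ) | IsOpen U} from
      BorelSpace.measurable_eq) isPiSystem_isOpen with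
  | empty => exact hopen isOpen_empty
  | basic U hU => exact hopen hU
  | compl B _ ih =>
    have hadd : massOut ((Bᶜ ∩ within Ξ n).indicator 1) + massOut ((B ∩ within Ξ n).indicator 1) =
        massOut ((within Ξ n).indicator 1) := by
      rw [← massOut_add]
      congr 1
      ext g
      by_cases h : g ∈ B <;> by_cases h' : g ∈ within Ξ n <;> simp [h, h']
    have hfin : ∀ g, massOut ((B ∩ within Ξ n).indicator 1) g ≠ ∞ := fun g =>
      ne_top_of_le_ne_top (massOut_within_ne_top n g) (by
        rw [← hadd]; exact le_add_self)
    have : massOut ((Bᶜ ∩ within Ξ n).indicator 1) =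
        massOut ((within Ξ n).indicator 1) - massOut ((B ∩ within Ξ n).indicator 1) := by
      rw [← hadd]
      ext g
      simp [ENNReal.add_sub_cancel_right (hfin g)]
    rw [this]
    have := hopen isOpen_univ
    rw [Set.univ_inter] at this
    exact this.sub ih
  | iUnion B hd _ ih =>
    have : ((⋃ i, B i) ∩ within Ξ n).indicator (1 : GStarStar Ξ → ℝ≥0∞) =
        fun g => ∑' i, (B i ∩ within Ξ n).indicator 1 g := by
      ext g
      by_cases h : g ∈ (⋃ i, B i) ∩ within Ξ n
      · obtain ⟨i, hi⟩ := Set.mem_iUnion.1 h.1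
        rw [Set.indicator_of_mem h, tsum_eq_single i fun j hj => Set.indicator_of_notMem
          (fun hg => Set.disjoint_left.1 (hd hj) hg.1 hi) _, Set.indicator_of_mem (Set.mem_inter hi h.2)]
      · rw [Set.indicator_of_notMem h]
        refine (ENNReal.tsum_eq_zero.2 fun i => Set.indicator_of_notMem (fun hg => h ?_) _).symm
        exact ⟨Set.mem_iUnion.2 ⟨i, hg.1⟩, hg.2⟩
    rw [this, massOut_tsum]
    exact Measurable.tsum ih

/-- By connectedness every pair is at finite distance, so the truncations increase to `B`. -/
theorem measurable_massOut_indicator {B : Set (GStarStar Ξ)} (hB : MeasurableSet B) :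
    Measurable (massOut (B.indicator 1)) := by
  have hmono : Monotone (within Ξ) := by
    rintro m n hmn _ ⟨N, x, y, hy, rfl⟩
    exact ⟨N, x, y, N.ball_mono _ hmn hy, rfl⟩
  have : B.indicator (1 : GStarStar Ξ → ℝ≥0∞) =
      fun g => ⨆ n, (B ∩ within Ξ n).indicator 1 g := by
    ext g
    obtain ⟨N, x, y, rfl⟩ := exists_birooted g
    obtain ⟨n, hn⟩ := N.connected.exists_mem_ball x y
    refine le_antisymm ?_ (iSup_le fun n =>
      Set.indicator_le_indicator_of_subset Set.inter_subset_left (fun _ => zero_le) _)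
    refine le_iSup_of_le n ?_
    by_cases h : mk (birooted N x y) ∈ B <;> simp [h, mk_mem_within.2 hn]
  rw [this, massOut_iSup fun m n hmn => Set.indicator_le_indicator_of_subset
    (Set.inter_subset_inter_right _ (hmono hmn)) (fun _ => zero_le)]
  exact Measurable.iSup fun n => measurable_massOut_indicator_inter_within n hB

theorem measurable_massOut {f : GStarStar Ξ → ℝ≥0∞} (hf : Measurable f) :
    Measurable (massOut f) := by
  refine Measurable.ennreal_induction (motive := fun f => Measurable (massOut f)) ?_ ?_ ?_ hf
  · intro c s hs
    have : (s.indicator fun _ => c) = fun g => c * s.indicator (1 : GStarStar Ξ → ℝ≥0∞) g := by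
      ext g
      by_cases h : g ∈ s <;> simp [h]
    rw [this, massOut_const_mul]
    exact (measurable_massOut_indicator hs).const_mul c
  · intro f f' _ _ _ ih ih'
    rw [massOut_add]
    exact ih.add ih'
  · intro f _ hmono ih
    rw [massOut_iSup hmono]
    exact Measurable.iSup ih

theorem measurable_massIn {f : GStarStar Ξ → ℝ≥0∞} (hf : Measurable f) :
    Measurable (massIn f) := by
  rw [massIn_eq_massOut_swap]
  exact measurable_massOut (hf.comp measurable_swap)

end NetworkClass

/-! ### Invariant events, saturations and conditioning. -/

namespace NetworkClass

open PointedNetwork Topology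

variable {Ξ : Type u}

theorem mem_iff_of_rootInvariant {A : Set (GStar Ξ)} (hA : RootInvariant A) (N : Network Ξ)
    (x y : N.V) : mk (rooted N x) ∈ A ↔ mk (rooted N y) ∈ A :=
  ⟨hA N N x y ⟨Network.Iso.refl N⟩, hA N N y x ⟨Network.Iso.refl N⟩⟩

/-- The classes `[G, o]` for which some `[G, x]` belongs to `S`. -/
def saturation (S : Set (GStar Ξ)) : Set (GStar Ξ) :=
  {g | ∃ (N : Network Ξ) (x y : N.V), mk (rooted N x) = g ∧ mk (rooted N y) ∈ S}

theorem subset_saturation (S : Set (GStar Ξ)) : S ⊆ saturation S := by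
  intro g hg
  obtain ⟨N, x, rfl⟩ := exists_rooted g
  exact ⟨N, x, x, rfl, hg⟩

theorem rootInvariant_saturation (S : Set (GStar Ξ)) : RootInvariant (saturation S) := by
  rintro G H x y ⟨φ⟩ ⟨N, a, b, hab, hb⟩
  obtain ⟨ψ, -⟩ := Quotient.exact hab
  refine ⟨H, y, φ.toV (ψ.toV b), rfl, ?_⟩
  have : mk (rooted N b) = mk (rooted H (φ.toV (ψ.toV b))) :=
    Quotient.sound ⟨ψ.trans φ, fun i => by fin_cases i; rfl⟩
  rwa [← this]

/-- This replaces an existential over vertices by positivity of a vertex sum, from which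
measurability follows. -/
theorem saturation_eq (S : Set (GStar Ξ)) :
    saturation S = {g | massOut ((snd ⁻¹' S).indicator 1) g = 0}ᶜ := by
  ext g
  obtain ⟨N, x, rfl⟩ := exists_rooted g
  simp only [Set.mem_compl_iff, Set.mem_ofPred_eq, massOut_mk, ENNReal.tsum_eq_zero, not_forall,
    Set.indicator_apply_eq_zero, Set.mem_preimage, snd_mk, Pi.one_apply, one_ne_zero, imp_false,
    not_not]
  constructor
  · rintro ⟨M, a, b, hab, hb⟩
    obtain ⟨ψ, -⟩ := Quotient.exact hab
    refine ⟨ψ.toV b, ?_⟩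
    have : mk (rooted M b) = mk (rooted N (ψ.toV b)) :=
      Quotient.sound ⟨ψ, fun i => by fin_cases i; rfl⟩
    rwa [← this]
  · rintro ⟨y, hy⟩
    exact ⟨N, x, y, rfl, hy⟩

variable [MetricSpace Ξ]

theorem measurableSet_saturation {S : Set (GStar Ξ)} (hS : MeasurableSet S) :
    MeasurableSet (saturation S) := by
  rw [saturation_eq]
  have := measurable_massOut_indicator (measurable_snd hS)
  exact (measurableSet_eq_fun this measurable_const).compl

/-- Conditioning a unimodular measure on an invariant event gives a unimodular measure. -/
theorem cond_mem_unimodular {μ : Measure (GStar Ξ)} (hμ : μ ∈ unimodular Ξ) {A : Set (GStar Ξ)}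
    (hA : MeasurableSet A) (hinv : RootInvariant A) (h0 : μ A ≠ 0) :
    ProbabilityTheory.cond μ A ∈ unimodular Ξ := by
  obtain ⟨hprob, hmtp⟩ := hμ
  refine ⟨ProbabilityTheory.cond_isProbabilityMeasure h0, fun f hf => ?_⟩
  rw [ProbabilityTheory.cond, lintegral_smul_measure, lintegral_smul_measure]
  congr 1
  rw [← lintegral_indicator hA, ← lintegral_indicator hA]
  have hout : A.indicator (massOut f) =
      massOut fun g => A.indicator (1 : GStar Ξ → ℝ≥0∞) (fst g) * f g := by
    rw [massOut_fst_mul]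
    ext g
    by_cases h : g ∈ A <;> simp [h]
  have hin : A.indicator (massIn f) =
      massIn fun g => A.indicator (1 : GStar Ξ → ℝ≥0∞) (fst g) * f g := by
    -- Invariance of `A` lets the indicator be read at either end of the pair, so one and the same
    -- mass serves both sides.
    have : (fun g => A.indicator (1 : GStar Ξ → ℝ≥0∞) (fst g) * f g) =
        fun g => A.indicator (1 : GStar Ξ → ℝ≥0∞) (snd g) * f g := by
      ext g
      obtain ⟨N, x, y, rfl⟩ := exists_birooted g
      rw [fst_mk, snd_mk]
      by_cases h : mk (rooted N x) ∈ A
      · simp [h, (mem_iff_of_rootInvariant hinv N x y).1 h]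
      · simp [h, mt (mem_iff_of_rootInvariant hinv N x y).2 h]
    rw [this, massIn_snd_mul]
    ext g
    by_cases h : g ∈ A <;> simp [h]
  rw [hout, hin]
  exact hmtp _ (((measurable_one.indicator hA).comp measurable_fst).mul hf)

theorem isTrivialFor_of_mem_extremePoints {μ : Measure (GStar Ξ)}
    (h : μ ∈ Set.extremePoints ℝ≥0 (unimodular Ξ)) : IsTrivialFor (invariantSigma Ξ) μ := by
  rintro A ⟨hA, hinv⟩
  obtain ⟨hμ, hext⟩ := h
  have hprob : IsProbabilityMeasure μ := hμ.1
  by_cases h0 : μ A = 0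
  · exact Or.inl h0
  by_cases h1 : μ Aᶜ = 0
  · exact Or.inr ((prob_compl_eq_zero_iff hA).1 h1)
  have hinv' : RootInvariant Aᶜ := (((invariantSigma Ξ).measurableSet_compl A) ⟨hA, hinv⟩).2
  have hseg : μ ∈ openSegment ℝ≥0 (ProbabilityTheory.cond μ A) (ProbabilityTheory.cond μ Aᶜ) := by
    refine ⟨(μ A).toNNReal, (μ Aᶜ).toNNReal, ENNReal.toNNReal_pos h0 (measure_ne_top _ _),
      ENNReal.toNNReal_pos h1 (measure_ne_top _ _), ?_, ?_⟩
    · rw [← ENNReal.toNNReal_add (measure_ne_top _ _) (measure_ne_top _ _),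
        prob_add_prob_compl hA, ENNReal.toNNReal_one]
    · ext s hs
      have e : ∀ B : Set (GStar Ξ), MeasurableSet B → μ B ≠ 0 →
          ((μ B).toNNReal • ProbabilityTheory.cond μ B) s = μ (s ∩ B) := by
        intro B hB hB0
        rw [Measure.smul_apply, ProbabilityTheory.cond_apply hB, ENNReal.smul_def,
          ENNReal.coe_toNNReal (measure_ne_top _ _), smul_eq_mul, ← mul_assoc,
          ENNReal.mul_inv_cancel hB0 (measure_ne_top _ _), one_mul, Set.inter_comm]
      rw [Measure.add_apply, e A hA h0, e Aᶜ hA.compl h1, ← Set.sdiff_eq, measure_inter_add_sdiff s hA]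
  have heq := hext (cond_mem_unimodular hμ hA hinv h0)
    (cond_mem_unimodular hμ hA.compl hinv' h1) hseg
  refine Or.inr ?_
  rw [← heq, ProbabilityTheory.cond_apply hA, Set.inter_self,
    ENNReal.inv_mul_cancel h0 (measure_ne_top _ _)]

/-! ### Densities between unimodular measures, and extremality. -/

/-- The density `h` of a unimodular measure with respect to a unimodular measure can be moved from
the sender to the receiver of the mass. -/
theorem lintegral_massOut_snd_mul {μ : Measure (GStar Ξ)} (hμ : μ ∈ unimodular Ξ)
    {h : GStar Ξ → ℝ≥0∞} (hh : Measurable h) (hν : μ.withDensity h ∈ unimodular Ξ)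
    {f : GStarStar Ξ → ℝ≥0∞} (hf : Measurable f) :
    ∫⁻ g, massOut (fun g => h (snd g) * f g) g ∂μ = ∫⁻ g, h g * massOut f g ∂μ := by
  have := hν.2 f hf
  rw [lintegral_withDensity_eq_lintegral_mul _ hh (measurable_massOut hf),
    lintegral_withDensity_eq_lintegral_mul _ hh (measurable_massIn hf)] at this
  have hf' : Measurable fun g => h (snd g) * f g := (hh.comp measurable_snd).mul hf
  -- Mass transport for `μ` brings the left side to `∫ h * massIn f`; mass transport for the measure
  -- with density `h` identifies this with the right side.
  rw [hμ.2 _ hf', massIn_snd_mul]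
  exact this.symm

/-- Almost surely the density of a unimodular measure with respect to a unimodular measure exceeds
`1` at the root if it exceeds `1` at some vertex. -/
theorem ae_one_lt_of_mem_saturation {μ : Measure (GStar Ξ)} (hμ : μ ∈ unimodular Ξ)
    {h : GStar Ξ → ℝ≥0∞} (hh : Measurable h) (hν : μ.withDensity h ∈ unimodular Ξ) :
    ∀ᵐ g ∂μ, g ∈ saturation {g | 1 < h g} → 1 < h g := by
  have hprob : IsProbabilityMeasure μ := hμ.1
  set S : Set (GStar Ξ) := {g | 1 < h g}
  have hS : MeasurableSet S := measurableSet_lt measurable_const hh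
  -- In `f n M`, a vertex with `h ≤ 1` sends unit mass to each vertex within distance `n` where `h >
  -- 1`, provided there are at most `M` of these. The bound `M` makes the expected mass finite, so
  -- that it can be cancelled.
  let w (n : ℕ) : GStarStar Ξ → ℝ≥0∞ := (within Ξ n ∩ snd ⁻¹' S).indicator 1
  have hw : ∀ n, Measurable (w n) := fun n =>
    measurable_one.indicator ((isOpen_within n).measurableSet.inter (measurable_snd hS))
  let T (n M : ℕ) : Set (GStar Ξ) := {g | massOut (w n) g ≤ M} ∩ Sᶜ
  have hT : ∀ n M, MeasurableSet (T n M) := fun n M =>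
    (measurableSet_le (measurable_massOut (hw n)) measurable_const).inter hS.compl
  let f (n M : ℕ) : GStarStar Ξ → ℝ≥0∞ := fun g => (T n M).indicator 1 (fst g) * w n g
  have hf : ∀ n M, Measurable (f n M) := fun n M =>
    ((measurable_one.indicator (hT n M)).comp measurable_fst).mul (hw n)
  have hf' : ∀ n M, Measurable fun g => (h (snd g) - 1) * f n M g := fun n M =>
    ((hh.comp measurable_snd).sub measurable_const).mul (hf n M)
  have hzero : ∀ n M, ∀ᵐ g ∂μ, massOut (fun g => (h (snd g) - 1) * f n M g) g = 0 := by
    intro n M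
    -- Mass goes only to vertices where `h > 1`, so the truncated subtraction in `h - 1` loses
    -- nothing.
    have hsplit : (fun g => h (snd g) * f n M g) =
        f n M + fun g => (h (snd g) - 1) * f n M g := by
      ext g
      by_cases hg : snd g ∈ S
      · have : 1 ≤ h (snd g) := le_of_lt hg
        conv_lhs => rw [← add_tsub_cancel_of_le this, add_mul, one_mul]
        rfl
      · have : f n M g = 0 := by simp [f, w, hg]
        simp [this]
    have hout : massOut (f n M) = fun g => (T n M).indicator 1 g * massOut (w n) g :=
      massOut_fst_mul _ _
    -- Senders have `h ≤ 1`. Moving `h` to the receiver then bounds the total plus the excess by the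
    -- total, so the excess vanishes.
    have hle : ∫⁻ g, h g * massOut (f n M) g ∂μ ≤ ∫⁻ g, massOut (f n M) g ∂μ := by
      refine lintegral_mono fun g => ?_
      by_cases hg : g ∈ T n M
      · exact mul_le_of_le_one_left zero_le (not_lt.1 hg.2)
      · simp [hout, hg]
    have hfin : ∫⁻ g, massOut (f n M) g ∂μ ≠ ∞ := by
      refine ne_top_of_le_ne_top (ENNReal.natCast_ne_top M) ?_
      calc ∫⁻ g, massOut (f n M) g ∂μ ≤ ∫⁻ _, M ∂μ := by
            refine lintegral_mono fun g => ?_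
            by_cases hg : g ∈ T n M
            · simpa [hout, hg] using hg.1
            · simp [hout, hg]
        _ = M := by simp
    rw [← lintegral_massOut_snd_mul hμ hh hν (hf n M), hsplit, massOut_add] at hle
    simp only [Pi.add_apply] at hle
    rw [lintegral_add_left (measurable_massOut (hf n M))] at hle
    have h0 : ∫⁻ g, massOut (fun g => (h (snd g) - 1) * f n M g) g ∂μ = 0 := by
      have := (ENNReal.cancel_of_ne hfin).add_le_iff_nonpos_right.1 hle
      exact nonpos_iff_eq_zero.1 this
    exact (lintegral_eq_zero_iff (measurable_massOut (hf' n M))).1 h0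
  have hall := ae_all_iff.2 fun n => ae_all_iff.2 (hzero n)
  filter_upwards [hall] with g hg hsat
  obtain ⟨N, x, y, rfl, hy⟩ := hsat
  by_contra hx
  obtain ⟨n, hn⟩ := N.connected.exists_mem_ball x y
  have hne : massOut (w n) (mk (rooted N x)) ≠ ∞ := by
    refine ne_top_of_le_ne_top (massOut_within_ne_top n (mk (rooted N x))) ?_
    simp only [massOut_mk]
    exact ENNReal.tsum_le_tsum fun z => Set.indicator_le_indicator_of_subset
      Set.inter_subset_left (fun _ => zero_le) _
  obtain ⟨M, hM⟩ := ENNReal.exists_nat_gt hne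
  have hmem : mk (rooted N x) ∈ T n M := ⟨hM.le, hx⟩
  have hwmem : mk (birooted N x y) ∈ within Ξ n ∩ snd ⁻¹' S :=
    ⟨mk_mem_within.2 hn, by rw [Set.mem_preimage, snd_mk]; exact hy⟩
  have := hg n M
  rw [massOut_mk, ENNReal.tsum_eq_zero] at this
  have := this y
  simp only [f, w, fst_mk, snd_mk, Set.indicator_of_mem hmem, Set.indicator_of_mem hwmem,
    Pi.one_apply, mul_one] at this
  exact (not_le.2 hy) (tsub_eq_zero_iff_le.1 this)

/-- A unimodular measure for which the invariant σ-field is trivial is the only unimodular measure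
absolutely continuous with respect to it. -/
theorem eq_of_absolutelyContinuous {μ ν : Measure (GStar Ξ)} (hμ : μ ∈ unimodular Ξ)
    (hν : ν ∈ unimodular Ξ) (htriv : IsTrivialFor (invariantSigma Ξ) μ) (hac : ν ≪ μ) : ν = μ := by
  have hprob : IsProbabilityMeasure μ := hμ.1
  have hprob' : IsProbabilityMeasure ν := hν.1
  have hd := Measure.withDensity_rnDeriv_eq ν μ hac
  have hh := Measure.measurable_rnDeriv ν μ
  set h := ν.rnDeriv μ
  have hint : ∫⁻ g, h g ∂μ = 1 := by
    rw [← setLIntegral_univ, ← withDensity_apply _ MeasurableSet.univ, hd, measure_univ]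
  have hint' : ∫⁻ _, 1 ∂μ = 1 := by simp
  suffices h =ᵐ[μ] 1 by
    rw [← hd, withDensity_congr_ae this, withDensity_one]
  have hS : MeasurableSet {g | 1 < h g} := measurableSet_lt measurable_const hh
  have hsat := measurableSet_saturation hS
  -- Either `h ≤ 1` a.e. or `h > 1` a.e.; in both cases the comparison with 1 is an equality because
  -- the integrals agree.
  rcases htriv _ ⟨hsat, rootInvariant_saturation _⟩ with h0 | h1
  · have hle : h ≤ᵐ[μ] 1 := by
      filter_upwards [measure_eq_zero_iff_ae_notMem.1 h0] with g hg
      exact not_lt.1 fun hlt => hg (subset_saturation _ hlt)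
    exact ae_eq_of_ae_le_of_lintegral_le hle (by simp [hint]) aemeasurable_const
      (by simp only [Pi.one_apply]; rw [hint, hint'])
  · have hle : 1 ≤ᵐ[μ] h := by
      filter_upwards [ae_one_lt_of_mem_saturation hμ hh (hd.symm ▸ hν),
        (mem_ae_iff_prob_eq_one hsat).2 h1] with g hg hg'
      exact (hg hg').le
    exact (ae_eq_of_ae_le_of_lintegral_le hle (by simp) hh.aemeasurable
      (by simp only [Pi.one_apply]; rw [hint, hint'])).symm

theorem mem_extremePoints_of_isTrivialFor {μ : Measure (GStar Ξ)} (hμ : μ ∈ unimodular Ξ)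
    (htriv : IsTrivialFor (invariantSigma Ξ) μ) : μ ∈ Set.extremePoints ℝ≥0 (unimodular Ξ) := by
  refine ⟨hμ, fun ν hν ν' _ hseg => eq_of_absolutelyContinuous hμ hν htriv ?_⟩
  -- A component of positive weight `a` vanishes on every null set of the mixture.
  obtain ⟨a, b, ha, -, -, rfl⟩ := hseg
  refine Measure.AbsolutelyContinuous.mk fun s _ hs => ?_
  rw [Measure.add_apply, add_eq_zero, Measure.smul_apply, ENNReal.smul_def, smul_eq_mul,
    mul_eq_zero] at hs
  exact hs.1.resolve_left (by exact_mod_cast ha.ne')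

end NetworkClass

theorem theoremt {Ξ : Type u} [MetricSpace Ξ] [CompleteSpace Ξ]
    [TopologicalSpace.SeparableSpace Ξ] (μ : Measure (GStar Ξ)) (hμ : μ ∈ unimodular Ξ) :
    μ ∈ Set.extremePoints ℝ≥0 (unimodular Ξ) ↔ IsTrivialFor (invariantSigma Ξ) μ :=
  ⟨NetworkClass.isTrivialFor_of_mem_extremePoints,
    NetworkClass.mem_extremePoints_of_isTrivialFor hμ⟩
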